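/- Fix integers $n\ge 3$ and $N\ge 0$. Let $(R_s,\hat R_s)$, $1\le s\le n$, be i.i.d. pairs (true reward, surrogate reward) of an arm $k$ with the bivariate normal law $$\mathcal N\left(\begin{pmatrix}\mu_k\\ \tilde\mu_k\end{pmatrix},\begin{pmatrix}\sigma_k^2&\rho_k\sigma_k\tilde\sigma_k\\ \rho_k\sigma_k\tilde\sigma_k&\tilde\sigma_k^2\end{pmatrix}\right),\qquad \sigma_k\ge 0,\ \tilde\sigma_k>0,\ |\rho_k|\le 1,$$ where all five parameters are arbitrary. Let $\hat R^{\mathrm{off}}_s$, $1\le s\le N$, be i.i.d. offline surrogate rewards with law $\mathcal N(\tilde\mu_k,\tilde\sigma_k^2)$, independent of the pairs $(R_s,\hat R_s)$. Write $$\bar R=\frac1n\sum_{s=1}^n R_s,\quad \bar{\hat R}=\frac1n\sum_{s=1}^n\hat R_s,\quad \bar{\hat R}^{\mathrm{off}}=\frac1N\sum_{s=1}^N\hat R^{\mathrm{off}}_s,\quad \bar{\hat R}^{\mathrm{all}}=\frac1{n+N}\Big(\sum_{s=1}^n\hat R_s+\sum_{s=1}^N\hat R_s^{\mathrm{off}}\Big),$$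 $$\hat\beta=\frac{\sum_{s=1}^n(R_s-\bar R)(\hat R_s-\bar{\hat R})}{\sum_{s=1}^n(\hat R_s-\bar{\hat R})^2},\qquad \hat\mu=\bar R-\frac{N}{n+N}\,\hat\beta\,\big(\bar{\hat R}-\bar{\hat R}^{\mathrm{off}}\big),\qquad Z=1+\frac{n\,(\bar{\hat R}-\bar{\hat R}^{\mathrm{all}})^2}{\sum_{s=1}^n(\hat R_s-\bar{\hat R})^2}$$ (for $N=0$, $\hat\mu=\bar R$). The numbers $\hat\mu$ and $\hat\beta$ are the intercept and the slope of the ordinary least squares regression of $R_s$ on $\hat R_s-\bar{\hat R}^{\mathrm{all}}$. Let $$\hat\sigma_R^2=\frac1{n-1}\sum_{s=1}^n(R_s-\bar R)^2,\qquad \hat\sigma_\epsilon^2=\frac1{n-2}\sum_{s=1}^n\Big(R_s-\hat\mu-\hat\beta\,(\hat R_s-\bar{\hat R}^{\mathrm{all}})\Big)^2$$ be the sample variance of the true rewards and the residual mean square of this regression. Then for every $\delta\in(0,1)$ $$\mathbb P\left(\mu_k\le\hat\mu+q_{n-2}(\delta)\left(\sqrt{\frac{\hat\sigma_R^2}{n+N}}+\sqrt{\frac{Z\,\hat\sigma_\epsilon^2}{n}}\right)\right)\ge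 1-2\delta,$$ where $q_d(\delta)$ is the $1-\delta$ quantile of Student's t-distribution with $d$ degrees of freedom. (The claim is informative for $\delta<\tfrac12$.) The bound is computed from the data and $\delta$ alone, without knowledge of the means, variances or correlation. -/

import Mathlib

open MeasureTheory ProbabilityTheory

namespace MLAUCB

noncomputable section

/-! ### Student's t-distribution and its quantiles -/

/-- The chi-squared distribution with `d` degrees of freedom: the law of the sum of the squares of
`d` independent standard normal variables. -/
def chiSquared (d : ℕ) : Measure ℝ :=
  (Measure.pi fun _ : Fin d => gaussianReal 0 1).map fun x => ∑ i, x i ^ 2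

/-- Student's t-distribution with `d` degrees of freedom (`1 ≤ d`): the law of `X / √(Y / d)`, where
`X` is standard normal, `Y` is chi-squared with `d` degrees of freedom, and `X`, `Y` are
independent. -/
def studentT (d : ℕ) : Measure ℝ :=
  ((gaussianReal 0 1).prod (chiSquared d)).map fun p => p.1 / √(p.2 / d)

instance isProbabilityMeasure_chiSquared (d : ℕ) : IsProbabilityMeasure (chiSquared d) :=
  Measure.isProbabilityMeasure_map (Measurable.aemeasurable (by fun_prop))

instance isProbabilityMeasure_studentT (d : ℕ) : IsProbabilityMeasure (studentT d) :=
  Measure.isProbabilityMeasure_map (Measurable.aemeasurable (by fun_prop))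

/-- `tQuantile d δ` is the `1 - δ` quantile of Student's t-distribution with `d` degrees of freedom,
for `0 < δ < 1`. -/
def tQuantile (d : ℕ) (δ : ℝ) : ℝ :=
  sInf {x : ℝ | 1 - δ ≤ cdf (studentT d) x}

/-! ### Statistics of the data

The data are the true rewards `r` and the surrogate rewards `rh` of the `n` online pulls, and the
`N` offline surrogate rewards `roff`. -/

/-- The sample mean. -/
def mean {m : ℕ} (x : Fin m → ℝ) : ℝ := (∑ s, x s) / m

/-- The pooled mean of the online and offline surrogate rewards. -/
def pooledMean {n N : ℕ} (rh : Fin n → ℝ) (roff : Fin N → ℝ) : ℝ :=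
  (∑ s, rh s + ∑ s, roff s) / ((n : ℝ) + N)

/-- The sample covariance, with denominator `n`. -/
def sampleCov {n : ℕ} (r rh : Fin n → ℝ) : ℝ :=
  (∑ s, (r s - mean r) * (rh s - mean rh)) / n

/-- The sample variance, with denominator `n`. -/
def sampleVar {n : ℕ} (rh : Fin n → ℝ) : ℝ :=
  (∑ s, (rh s - mean rh) ^ 2) / n

/-- The tuning parameter `N / (n + N) * Cov / Var`. -/
def lambdaHat {n : ℕ} (N : ℕ) (r rh : Fin n → ℝ) : ℝ :=
  (N : ℝ) / ((n : ℝ) + N) * (sampleCov r rh / sampleVar rh)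

/-- The machine learning-assisted mean estimator. -/
def mlaMean {n N : ℕ} (r rh : Fin n → ℝ) (roff : Fin N → ℝ) : ℝ :=
  mean r - lambdaHat N r rh * (mean rh - mean roff)

/-- The least squares objective of the regression of `r` on the surrogate rewards centred at their
pooled mean, with intercept `a` and slope `b`. -/
def olsLoss {n N : ℕ} (r rh : Fin n → ℝ) (roff : Fin N → ℝ) (a b : ℝ) : ℝ :=
  ∑ s, (r s - a - b * (rh s - pooledMean rh roff)) ^ 2

/-- The least squares slope. -/
def olsSlope {n : ℕ} (r rh : Fin n → ℝ) : ℝ := sampleCov r rh / sampleVar rh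

/-- The unbiased sample variance of the true rewards, with denominator `n - 1`. -/
def rewardVar {n : ℕ} (r : Fin n → ℝ) : ℝ :=
  1 / ((n : ℝ) - 1) * ∑ s, (r s - mean r) ^ 2

/-- The residual mean square of the least squares fit, whose intercept is `mlaMean` and whose slope
is `olsSlope` (see `olsLoss_fit_le`), with denominator `n - 2`. -/
def residVar {n N : ℕ} (r rh : Fin n → ℝ) (roff : Fin N → ℝ) : ℝ :=
  1 / ((n : ℝ) - 2) *
    ∑ s, (r s - mlaMean r rh roff - olsSlope r rh * (rh s - pooledMean rh roff)) ^ 2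

/-- The factor `Z = 1 + n (mean - pooled mean)² / ∑ (surrogate - mean)²`. -/
def zFactor {n N : ℕ} (rh : Fin n → ℝ) (roff : Fin N → ℝ) : ℝ :=
  1 + n * (mean rh - pooledMean rh roff) ^ 2 / ∑ s, (rh s - mean rh) ^ 2

/-- Whenever the online surrogate rewards are not all equal, `mlaMean` and `olsSlope` minimise the
least squares objective, so that `residVar` is indeed the residual mean square of that fit. -/
theorem olsLoss_fit_le {n N : ℕ} (r rh : Fin n → ℝ) (roff : Fin N → ℝ)
    (hv : sampleVar rh ≠ 0) (a b : ℝ) :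
    olsLoss r rh roff (mlaMean r rh roff) (olsSlope r rh) ≤ olsLoss r rh roff a b := by
  have hn : (n : ℝ) ≠ 0 := by
    intro h
    exact hv (by simp [sampleVar, h])
  have hnpos : (0 : ℝ) < n := lt_of_le_of_ne (Nat.cast_nonneg n) (Ne.symm hn)
  have hNn : (0 : ℝ) ≤ N := Nat.cast_nonneg N
  have hsumN : (∑ s, roff s) = N * mean roff := by
    rcases Nat.eq_zero_or_pos N with h | h
    · subst h
      simp
    · have : (N : ℝ) ≠ 0 := by positivity
      simp only [mean]
      field_simp
  have hsumr : (∑ s, r s) = n * mean r := by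
    simp only [mean]
    field_simp
  have hsumh : (∑ s, rh s) = n * mean rh := by
    simp only [mean]
    field_simp
  have hfit : mlaMean r rh roff = mean r - olsSlope r rh * (mean rh - pooledMean rh roff) := by
    have : (n : ℝ) + N ≠ 0 := by positivity
    simp only [mlaMean, lambdaHat, olsSlope, pooledMean, hsumN, hsumh]
    field_simp
    ring
  have h1 : ∑ s, (r s - mean r) = 0 := by
    rw [Finset.sum_sub_distrib, hsumr]
    simp
  have h2 : ∑ s, (rh s - mean rh) = 0 := by
    rw [Finset.sum_sub_distrib, hsumh]
    simp
  have hnormal : ∑ s, (r s - mean r) * (rh s - mean rh)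
      = olsSlope r rh * ∑ s, (rh s - mean rh) ^ 2 := by
    have hs : ∑ s, (rh s - mean rh) ^ 2 = n * sampleVar rh := by
      simp only [sampleVar]
      field_simp
    have hc : ∑ s, (r s - mean r) * (rh s - mean rh) = n * sampleCov r rh := by
      simp only [sampleCov]
      field_simp
    rw [hs, hc, olsSlope]
    field_simp
  have key : olsLoss r rh roff a b - olsLoss r rh roff (mlaMean r rh roff) (olsSlope r rh)
      = (olsSlope r rh - b) ^ 2 * ∑ s, (rh s - mean rh) ^ 2
        + n * (mean r - a - b * (mean rh - pooledMean rh roff)) ^ 2 := by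
    have e : ∀ s, (r s - a - b * (rh s - pooledMean rh roff)) ^ 2
        - (r s - mlaMean r rh roff - olsSlope r rh * (rh s - pooledMean rh roff)) ^ 2
        = 2 * (olsSlope r rh - b) * ((r s - mean r) * (rh s - mean rh))
          + (b ^ 2 - olsSlope r rh ^ 2) * (rh s - mean rh) ^ 2
          + 2 * (mean r - a - b * (mean rh - pooledMean rh roff)) * (r s - mean r)
          - 2 * b * (mean r - a - b * (mean rh - pooledMean rh roff)) * (rh s - mean rh)
          + (mean r - a - b * (mean rh - pooledMean rh roff)) ^ 2 := by
      intro s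
      rw [hfit]
      ring
    simp only [olsLoss]
    rw [← Finset.sum_sub_distrib, Finset.sum_congr rfl fun s _ => e s]
    simp only [Finset.sum_add_distrib, Finset.sum_sub_distrib, ← Finset.mul_sum, h1, h2, hnormal]
    simp
    ring
  have hpos : 0 ≤ (olsSlope r rh - b) ^ 2 * ∑ s, (rh s - mean rh) ^ 2
        + n * (mean r - a - b * (mean rh - pooledMean rh roff)) ^ 2 := by
    have : 0 ≤ ∑ s, (rh s - mean rh) ^ 2 := Finset.sum_nonneg fun s _ => sq_nonneg _
    positivity
  linarith

/-! ### The sampling model -/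

/-- The data of one arm: `n` online pairs (true reward, surrogate reward) that are i.i.d. bivariate
normal with means `μ`, `μ'`, standard deviations `σ`, `σ'` and correlation `ρ`, and `N` offline
surrogate rewards that are i.i.d. with the law of an online surrogate reward and independent of the
online pairs. -/
structure IsGaussianArm {Ω : Type*} [MeasurableSpace Ω] (P : Measure Ω) {n N : ℕ}
    (R Rhat : Fin n → Ω → ℝ) (Roff : Fin N → Ω → ℝ) (μ μ' σ σ' ρ : ℝ) : Prop where
  law_online : ∀ s, HasLaw (fun ω => (!₂[R s ω, Rhat s ω] : EuclideanSpace ℝ (Fin 2)))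
    (multivariateGaussian !₂[μ, μ'] !![σ ^ 2, ρ * σ * σ'; ρ * σ * σ', σ' ^ 2]) P
  law_offline : ∀ s, HasLaw (Roff s) (gaussianReal μ' (σ' ^ 2).toNNReal) P
  indep_online : iIndepFun (fun s ω => (R s ω, Rhat s ω)) P
  indep_offline : iIndepFun Roff P
  indep_online_offline :
    IndepFun (fun ω (s : Fin n) => (R s ω, Rhat s ω)) (fun ω (s : Fin N) => Roff s ω) P

end

end MLAUCB

namespace MLAUCB

noncomputable section

open Matrix

/-! Write the data through independent standard normals: `η` drives the online surrogates, `ζ` the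
offline ones, and `ξ` is the part of the true rewards independent of the surrogates. With `b =
σρ/σ'`, `a = μ - bμ'` and `τ = σ√(1-ρ²)` the rewards satisfy `R = a + b Rhat + τξ`, and with `M` the
pooled surrogate mean the error splits as `μ - mlaMean = (a + bM - mlaMean) - b(M - μ')`.

Given the surrogates, the first term is the error of a least squares fitted value at `M`: it equals
`τ√(Z/n)` times a standard normal that is independent of the residuals, so its studentization has
exactly a t law with `n - 2` degrees of freedom (`exists_orthonormal_regression`,
`measure_regression_error_le`).

The second term is `σ|ρ|/√(n+N)` times a standard normal. That normal is independent of the sample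
variance of `R`, since the variance depends only on contrasts, which are orthogonal to sums.
Replacing `|ρ|` by `1` only enlarges a positive deviation, so the tail is at most that of a t law
with `n - 1` degrees of freedom (`exists_orthonormal_pooled`, `measure_pooled_error_le`). By
`studentT_succ_Ioi_le` the quantile for `n - 2` degrees serves here too.

Each term exceeds its bound with probability at most `δ`; the union bound needs no independence
between them. -/

/-- The standard normal law on `ι → ℝ`. -/
abbrev stdNormal (ι : Type*) [Fintype ι] : Measure (ι → ℝ) := Measure.pi fun _ => gaussianReal 0 1

/-! ### Orthonormal transformations of the standard normal law. -/

section Linear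

variable {ι κ : Type*} [Fintype ι] [Fintype κ]

lemma charFun_map_mulVec (A : Matrix κ ι ℝ) (t : EuclideanSpace ℝ κ) :
    charFun ((stdNormal ι).map fun x => WithLp.toLp 2 (A *ᵥ x)) t =
      Complex.exp (-((t.ofLp ᵥ* A) ⬝ᵥ (t.ofLp ᵥ* A) : ℝ) / 2) := by
  have h : charFun ((stdNormal ι).map (WithLp.toLp 2)) (WithLp.toLp 2 (t.ofLp ᵥ* A)) =
      Complex.exp (-((t.ofLp ᵥ* A) ⬝ᵥ (t.ofLp ᵥ* A) : ℝ) / 2) := by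
    rw [map_pi_eq_stdGaussian, charFun_stdGaussian, ← Complex.ofReal_pow,
      EuclideanSpace.real_norm_sq_eq]
    simp [dotProduct, sq]
  rw [← h, charFun_apply, charFun_apply, integral_map (by fun_prop) (by fun_prop),
    integral_map (by fun_prop) (by fun_prop)]
  congr with x
  congr 3
  simp only [EuclideanSpace.inner_eq_star_dotProduct, star_trivial]
  rw [dotProduct_mulVec, ← dotProduct_mulVec, dotProduct_mulVec]

variable [DecidableEq κ]

/-- The characteristic function sees `t` only through the norm of `Aᵀt`, which is that of `t` when
the rows are orthonormal. -/
lemma map_mulVec_stdNormal (A : Matrix κ ι ℝ) (hA : A * Aᵀ = 1) :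
    (stdNormal ι).map (fun x => A *ᵥ x) = stdNormal κ := by
  have h : (stdNormal ι).map (fun x => WithLp.toLp 2 (A *ᵥ x)) =
      (stdNormal κ).map (WithLp.toLp 2) := by
    refine Measure.ext_of_charFun (E := EuclideanSpace ℝ κ) ?_
    ext t
    rw [charFun_map_mulVec, map_pi_eq_stdGaussian, charFun_stdGaussian, ← Complex.ofReal_pow,
      EuclideanSpace.real_norm_sq_eq, ← dotProduct_mulVec, ← mulVec_transpose, mulVec_mulVec, hA,
      one_mulVec]
    simp [dotProduct, sq]
  have h2 := congrArg (fun m => m.map (WithLp.ofLp (p := 2))) h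
  rw [Measure.map_map (by fun_prop) (by fun_prop), Measure.map_map (by fun_prop) (by fun_prop)] at h2
  simpa [Function.comp_def] using h2

/-- An orthonormal family can be completed so that the coordinates compute the square norm. -/
lemma exists_orthonormal_completion [DecidableEq ι] {d : ℕ} (A : Matrix κ ι ℝ) (hA : A * Aᵀ = 1)
    (hd : Fintype.card ι = Fintype.card κ + d) :
    ∃ B : Matrix (Fin d) ι ℝ, fromRows A B * (fromRows A B)ᵀ = 1 ∧
      (fromRows A B)ᵀ * fromRows A B = 1 := by
  classical
  -- The zeros are placeholders: the extension theorem reads only the vectors indexed by `Sum.inl`.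
  let v : κ ⊕ Fin d → EuclideanSpace ℝ ι :=
    Sum.elim (fun a => WithLp.toLp 2 (A a)) fun _ => 0
  have hv : Orthonormal ℝ ((Set.range (Sum.inl : κ → κ ⊕ Fin d)).domRestrict v) := by
    rw [orthonormal_iff_ite]
    rintro ⟨_, a, rfl⟩ ⟨_, b, rfl⟩
    have := congrFun (congrFun hA b) a
    simp only [mul_apply, transpose_apply, one_apply] at this
    simp [v, EuclideanSpace.inner_eq_star_dotProduct, dotProduct, this, Subtype.ext_iff,
      eq_comm]
  obtain ⟨b, hb⟩ := hv.exists_orthonormalBasis_extension_of_card_eq (by simp [hd])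
  set C : Matrix (κ ⊕ Fin d) ι ℝ := of fun k => (b k).ofLp with hC
  have h1 : fromRows A (of fun j => (b (Sum.inr j)).ofLp) = C := by
    ext k i
    rcases k with a | j
    · simp [hC, hb (Sum.inl a) ⟨a, rfl⟩, v]
    · simp [hC]
  have hrow : C * Cᵀ = 1 := by
    ext k l
    have := orthonormal_iff_ite.1 b.orthonormal l k
    simp only [EuclideanSpace.inner_eq_star_dotProduct, star_trivial, dotProduct] at this
    simp [hC, mul_apply, one_apply, this, eq_comm]
  refine ⟨of fun j => (b (Sum.inr j)).ofLp, by rw [h1]; exact hrow, ?_⟩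
  rw [h1]
  exact (mul_eq_one_comm_of_card_eq _ _ _ (by simp [hd])).1 hrow

omit [DecidableEq κ] in
lemma dotProduct_self_eq_of_completion [DecidableEq ι] {d : ℕ} {A : Matrix κ ι ℝ}
    {B : Matrix (Fin d) ι ℝ} (h : (fromRows A B)ᵀ * fromRows A B = 1) (x : ι → ℝ) :
    x ⬝ᵥ x = (A *ᵥ x) ⬝ᵥ (A *ᵥ x) + (B *ᵥ x) ⬝ᵥ (B *ᵥ x) := by
  have : (fromRows A B *ᵥ x) ⬝ᵥ (fromRows A B *ᵥ x) = x ⬝ᵥ x := by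
    rw [dotProduct_mulVec, ← mulVec_transpose, mulVec_mulVec, h, one_mulVec]
  rw [← this, fromRows_mulVec]
  simp [dotProduct, Fintype.sum_sum_type]

end Linear

/-! ### Tails of Student's t-distribution. -/

section StudentT

/-- The Gaussian tail as a function of the squared threshold, scaled by `c`. -/
def gaussianTail (c v : ℝ) : ℝ := (gaussianReal 0 1).real (Set.Ioi (c * √v))

lemma measurable_gaussianTail (c : ℝ) : Measurable (gaussianTail c) := by
  have h : Antitone fun y => (gaussianReal 0 1).real (Set.Ioi y) := fun a b hab =>
    measureReal_mono (Set.Ioi_subset_Ioi hab)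
  exact h.measurable.comp (by fun_prop)

lemma gaussianReal_real_Ioi {y : ℝ} (hy : 0 ≤ y) :
    (gaussianReal 0 1).real (Set.Ioi y) =
      (gaussianReal 0 1).real (Set.Ioi 0) - ∫ x in (0 : ℝ)..y, gaussianPDFReal 0 1 x := by
  have h1 : (gaussianReal 0 1).real (Set.Ioc 0 y) =
      ∫ x in (0 : ℝ)..y, gaussianPDFReal 0 1 x := by
    rw [measureReal_def, gaussianReal_apply_eq_integral _ one_ne_zero,
      ENNReal.toReal_ofReal (integral_nonneg fun x => gaussianPDFReal_nonneg _ _ _),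
      intervalIntegral.integral_of_le hy]
  rw [← h1, ← Set.Ioc_union_Ioi_eq_Ioi hy, measureReal_union _ measurableSet_Ioi]
  · ring
  · exact Set.disjoint_left.2 fun x hx hx' => not_lt.2 hx.2 hx'

/-- The derivative is `-φ(c√v) c / (2√v)` with `φ` the normal density; both `φ(c√v)` and `1/√v`
decrease in `v`, so the derivative increases. -/
lemma convexOn_gaussianTail {c : ℝ} (hc : 0 ≤ c) : ConvexOn ℝ (Set.Ici 0) (gaussianTail c) := by
  have hpdf : Continuous (gaussianPDFReal 0 1) := by
    unfold gaussianPDFReal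
    fun_prop
  have hcont : Continuous fun v : ℝ => (gaussianReal 0 1).real (Set.Ioi 0)
      - ∫ x in (0 : ℝ)..(c * √v), gaussianPDFReal 0 1 x :=
    continuous_const.sub ((intervalIntegral.continuous_primitive
      (fun a b => hpdf.intervalIntegrable a b) 0).comp (by fun_prop))
  have heq : (fun v : ℝ => (gaussianReal 0 1).real (Set.Ioi 0)
      - ∫ x in (0 : ℝ)..(c * √v), gaussianPDFReal 0 1 x) = gaussianTail c := by
    ext v
    exact (gaussianReal_real_Ioi (by positivity)).symm
  have hderiv : ∀ v, 0 < v → HasDerivAt (gaussianTail c)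
      (-(gaussianPDFReal 0 1 (c * √v) * (c * (1 / (2 * √v))))) v := by
    intro v hv
    rw [← heq]
    exact ((hpdf.integral_hasStrictDerivAt 0 (c * √v)).hasDerivAt.comp v
      ((Real.hasDerivAt_sqrt hv.ne').const_mul c)).const_sub _
  refine MonotoneOn.convexOn_of_deriv (convex_Ici 0) (heq ▸ hcont.continuousOn) ?_ ?_
  · rw [interior_Ici]
    exact fun v hv => (hderiv v hv).differentiableAt.differentiableWithinAt
  · rw [interior_Ici]
    intro v hv w hw hvw
    rw [(hderiv v hv).deriv, (hderiv w hw).deriv]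
    have hv' : 0 < √v := Real.sqrt_pos.2 hv
    have hvw' : √v ≤ √w := Real.sqrt_le_sqrt hvw
    have : gaussianPDFReal 0 1 (c * √w) ≤ gaussianPDFReal 0 1 (c * √v) := by
      have hsq : (c * √v - 0) ^ 2 ≤ (c * √w - 0) ^ 2 := by
        simp only [sub_zero]
        gcongr
      unfold gaussianPDFReal
      gcongr
    have h0 := gaussianPDFReal_nonneg 0 1 (c * √v)
    gcongr

variable {d : ℕ}

lemma ae_sum_sq_pos (hd : 1 ≤ d) : ∀ᵐ y ∂stdNormal (Fin d), 0 < ∑ i, y i ^ 2 := by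
  have h : ∀ᵐ y ∂stdNormal (Fin d), y ⟨0, hd⟩ ≠ 0 := by
    have hae : ∀ᵐ t ∂gaussianReal 0 1, t ≠ 0 := by
      have := nullSingletonClass_gaussianReal (μ := 0) (v := 1) one_ne_zero
      exact Measure.ae_ne _ _
    exact (measurePreserving_eval (fun _ : Fin d => gaussianReal 0 1)
      ⟨0, hd⟩).quasiMeasurePreserving.ae hae
  filter_upwards [h] with y hy
  exact lt_of_lt_of_le (by positivity)
    (Finset.single_le_sum (f := fun i => y i ^ 2) (fun i _ => sq_nonneg (y i))
      (Finset.mem_univ (⟨0, hd⟩ : Fin d)))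

/-- Multiplying out the denominator is allowed almost surely, and makes the event meaningful where
the denominator vanishes. -/
lemma studentT_Ioi (hd : 1 ≤ d) (c : ℝ) :
    studentT d (Set.Ioi c) = ((gaussianReal 0 1).prod (stdNormal (Fin d)))
      {p | c * √((∑ i, p.2 i ^ 2) / d) < p.1} := by
  have hprod : (gaussianReal 0 1).prod (chiSquared d) =
      ((gaussianReal 0 1).prod (stdNormal (Fin d))).map fun p => (p.1, ∑ i, p.2 i ^ 2) := by
    have h := Measure.map_prod_map (gaussianReal 0 1) (stdNormal (Fin d)) (f := id)
      (g := fun x => ∑ i, x i ^ 2) measurable_id (by fun_prop)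
    rw [Measure.map_id] at h
    exact h
  rw [studentT, hprod, Measure.map_map (by fun_prop) (by fun_prop),
    Measure.map_apply (by fun_prop) measurableSet_Ioi]
  refine measure_congr ?_
  have h := (measurePreserving_snd (μ := gaussianReal 0 1)).quasiMeasurePreserving.ae
    (ae_sum_sq_pos hd)
  filter_upwards [h] with p hp
  have hd' : (0 : ℝ) < d := by exact_mod_cast hd
  have : 0 < √((∑ i, p.2 i ^ 2) / d) := by positivity
  exact propext (lt_div_iff₀ this)

lemma studentT_real_Ioi (hd : 1 ≤ d) (c : ℝ) :
    (studentT d).real (Set.Ioi c) =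
      ∫ y, gaussianTail c ((∑ i, y i ^ 2) / d) ∂stdNormal (Fin d) := by
  rw [measureReal_def, studentT_Ioi hd, Measure.prod_apply_symm
    (measurableSet_lt (by fun_prop) (by fun_prop)), ← integral_toReal]
  · rfl
  · exact (measurable_measure_prodMk_right
      (measurableSet_lt (by fun_prop) (by fun_prop))).aemeasurable
  · exact Filter.Eventually.of_forall fun y => measure_lt_top _ _

lemma integrable_gaussianTail_comp {Ω : Type*} [MeasurableSpace Ω] (P : Measure Ω)
    [IsFiniteMeasure P] (c : ℝ) {f : Ω → ℝ} (hf : Measurable f) :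
    Integrable (fun ω => gaussianTail c (f ω)) P :=
  Integrable.of_bound ((measurable_gaussianTail c).comp hf).aestronglyMeasurable 1
    (Filter.Eventually.of_forall fun ω => by
      rw [gaussianTail, Real.norm_of_nonneg measureReal_nonneg]
      exact measureReal_le_one)

/-- The upper tails of Student's t-distribution decrease with the degrees of freedom. -/
lemma studentT_succ_Ioi_le (hd : 1 ≤ d) {c : ℝ} (hc : 0 ≤ c) :
    (studentT (d + 1)).real (Set.Ioi c) ≤ (studentT d).real (Set.Ioi c) := by
  have hd' : (0 : ℝ) < d := by exact_mod_cast hd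
  rw [studentT_real_Ioi hd, studentT_real_Ioi (by lia)]
  have hmarg : ∀ j : Fin (d + 1),
      ∫ y, gaussianTail c ((∑ i, y (j.succAbove i) ^ 2) / d) ∂stdNormal (Fin (d + 1)) =
        ∫ y, gaussianTail c ((∑ i, y i ^ 2) / d) ∂stdNormal (Fin d) := by
    intro j
    have h := measurePreserving_snd.comp
      (measurePreserving_piFinSuccAbove (fun _ : Fin (d + 1) => gaussianReal 0 1) j)
    have hm : AEStronglyMeasurable (fun y : Fin d → ℝ => gaussianTail c ((∑ i, y i ^ 2) / d))
        ((stdNormal (Fin (d + 1))).map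
          (Prod.snd ∘ MeasurableEquiv.piFinSuccAbove (fun _ => ℝ) j)) :=
      ((measurable_gaussianTail c).comp (by fun_prop)).aestronglyMeasurable
    have hi := integral_map h.measurable.aemeasurable hm
    rw [h.map_eq] at hi
    exact hi.symm
  -- Jensen's inequality: `(∑ yᵢ²)/(d+1)` is the average of the `d + 1` leave-one-out values `(∑ yᵢ²
  -- - yⱼ²)/d`, and by `hmarg` each of these is distributed as a chi-squared variable divided by its
  -- `d` degrees of freedom.
  have hle : ∀ y : Fin (d + 1) → ℝ, gaussianTail c ((∑ i, y i ^ 2) / (d + 1 : ℕ)) ≤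
      ∑ j : Fin (d + 1), (1 / ((d : ℝ) + 1)) *
        gaussianTail c ((∑ i, y (j.succAbove i) ^ 2) / d) := by
    intro y
    have h := (convexOn_gaussianTail hc).map_sum_le (t := Finset.univ)
      (w := fun _ : Fin (d + 1) => 1 / ((d : ℝ) + 1))
      (p := fun j => (∑ i, y (j.succAbove i) ^ 2) / d)
      (fun _ _ => by positivity) (by simp; field_simp)
      (fun j _ => Set.mem_Ici.2 (by positivity))
    simp only [smul_eq_mul] at h
    refine le_of_eq_of_le (congrArg (gaussianTail c) ?_) h
    have hj : ∀ j : Fin (d + 1), ∑ i, y (j.succAbove i) ^ 2 = ∑ i, y i ^ 2 - y j ^ 2 :=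
      fun j => by rw [Fin.sum_univ_succAbove (fun i => y i ^ 2) j]; ring
    simp only [hj, ← Finset.mul_sum, ← Finset.sum_div, Finset.sum_sub_distrib]
    simp
    field_simp
    ring
  calc _ ≤ ∫ y, ∑ j : Fin (d + 1), (1 / ((d : ℝ) + 1)) *
        gaussianTail c ((∑ i, y (j.succAbove i) ^ 2) / d) ∂stdNormal (Fin (d + 1)) :=
        integral_mono (integrable_gaussianTail_comp _ c (by fun_prop))
          (integrable_finsetSum _ fun j _ =>
            (integrable_gaussianTail_comp _ c (by fun_prop)).const_mul _) hle
    _ = _ := by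
        rw [integral_finsetSum _ fun j _ =>
            (integrable_gaussianTail_comp _ c (by fun_prop)).const_mul _]
        simp only [integral_const_mul, hmarg]
        simp
        field_simp

/-- The common endpoint of both error estimates: one coordinate studentized by `d` further
orthonormal coordinates. -/
lemma studentT_Ioi_eq_of_orthonormal {ι : Type*} [Fintype ι] (hd : 1 ≤ d)
    {C : Matrix (Unit ⊕ Fin d) ι ℝ} (hC : C * Cᵀ = 1) (c : ℝ) :
    stdNormal ι {x | c * √((∑ j, (C *ᵥ x) (Sum.inr j) ^ 2) / d) < (C *ᵥ x) (Sum.inl ())} =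
      studentT d (Set.Ioi c) := by
  have h1 : MeasurePreserving (fun x : ι → ℝ => C *ᵥ x) (stdNormal ι)
      (stdNormal (Unit ⊕ Fin d)) := ⟨by fun_prop, map_mulVec_stdNormal C hC⟩
  have h2 := measurePreserving_sumPiEquivProdPi
    (fun _ : Unit ⊕ Fin d => gaussianReal 0 1)
  have h3 := (measurePreserving_eval (fun _ : Unit => gaussianReal 0 1) ()).prod
    (MeasurePreserving.id (stdNormal (Fin d)))
  have h := (h3.comp h2).comp h1
  rw [studentT_Ioi hd, ← h.measure_preimage
    (measurableSet_lt (by fun_prop) (by fun_prop)).nullMeasurableSet]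
  rfl

end StudentT

/-! ### Quantiles of Student's t-distribution. -/

section Quantile

variable {d : ℕ} {δ : ℝ}

lemma gaussianReal_Iio_zero_le : (gaussianReal 0 1).real (Set.Iio 0) ≤ 1 / 2 := by
  have h : (gaussianReal 0 1).real (Set.Ioi 0) = (gaussianReal 0 1).real (Set.Iio 0) := by
    have h := gaussianReal_map_neg (μ := 0) (v := 1)
    rw [neg_zero] at h
    conv_rhs => rw [← h, map_measureReal_apply (by fun_prop) measurableSet_Iio]
    congr 1
    ext x
    simp
  have h2 : (gaussianReal 0 1).real (Set.Iio 0 ∪ Set.Ioi 0) ≤ 1 := measureReal_le_one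
  rw [measureReal_union (Set.disjoint_left.2 fun x hx hx' =>
    lt_asymm (Set.mem_Iio.1 hx) (Set.mem_Ioi.1 hx')) measurableSet_Ioi, h] at h2
  linarith

/-- A negative ratio forces a negative numerator, which has probability at most one half. -/
lemma nonneg_of_le_cdf_studentT (hδ : δ < 1 / 2) {x : ℝ} (hx : 1 - δ ≤ cdf (studentT d) x) :
    0 ≤ x := by
  by_contra! hneg
  have h : cdf (studentT d) x ≤ 1 / 2 := by
    rw [cdf_eq_real, studentT, map_measureReal_apply (by fun_prop) measurableSet_Iic]
    refine le_trans ?_ gaussianReal_Iio_zero_le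
    have h1 : (gaussianReal 0 1).real (Set.Iio 0) =
        ((gaussianReal 0 1).prod (chiSquared d)).real (Prod.fst ⁻¹' Set.Iio 0) := by
      rw [← map_measureReal_apply measurable_fst measurableSet_Iio, measurePreserving_fst.map_eq]
    rw [h1]
    refine measureReal_mono fun p (hp : p.1 / √(p.2 / d) ≤ x) => ?_
    change p.1 < 0
    by_contra! h0
    have : 0 ≤ p.1 / √(p.2 / d) := by positivity
    linarith
  linarith

lemma tQuantile_nonneg (hδ : δ < 1 / 2) : 0 ≤ tQuantile d δ :=
  Real.sInf_nonneg fun _ hx => nonneg_of_le_cdf_studentT hδ hx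

/-- Right continuity of the distribution function shows that the infimum defining the quantile is
attained. -/
lemma studentT_Ioi_tQuantile_le (hδ : 0 < δ) :
    (studentT d).real (Set.Ioi (tQuantile d δ)) ≤ δ := by
  have hne : {x : ℝ | 1 - δ ≤ cdf (studentT d) x}.Nonempty :=
    ((tendsto_cdf_atTop (studentT d)).eventually (eventually_ge_nhds (by linarith))).exists
  have hright : ∀ y, tQuantile d δ < y → 1 - δ ≤ cdf (studentT d) y := by
    intro y hy
    obtain ⟨x, hx, hxy⟩ := exists_lt_of_csInf_lt hne hy
    exact le_trans hx (monotone_cdf _ hxy.le)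
  have hq : 1 - δ ≤ cdf (studentT d) (tQuantile d δ) := by
    have hc := ((cdf (studentT d)).right_continuous (tQuantile d δ)).mono_left
      (nhdsWithin_mono _ Set.Ioi_subset_Ici_self)
    exact ge_of_tendsto hc (Filter.eventually_of_mem self_mem_nhdsWithin hright)
  rw [cdf_eq_real] at hq
  rw [← Set.compl_Iic, probReal_compl_eq_one_sub measurableSet_Iic]
  linarith

end Quantile

/-! ### Generating the data from independent standard normals. -/

section Model

/-- Any factor of the covariance may replace its positive semidefinite square root, so the
triangular factor behind `rewardPair` can be used, even for singular covariances. -/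
lemma multivariateGaussian_mul_transpose {ι κ : Type*} [Fintype ι] [Fintype κ] [DecidableEq κ]
    (m : EuclideanSpace ℝ κ) (A : Matrix κ ι ℝ) :
    multivariateGaussian m (A * Aᵀ) =
      (stdNormal ι).map fun x => m + WithLp.toLp 2 (A *ᵥ x) := by
  have hA : (A * Aᵀ).PosSemidef := by
    simpa using posSemidef_self_mul_conjTranspose A
  have hcomp : ((stdNormal ι).map fun x => m + WithLp.toLp 2 (A *ᵥ x)) =
      ((stdNormal ι).map fun x => WithLp.toLp 2 (A *ᵥ x)).map (m + ·) := by
    rw [Measure.map_map (by fun_prop) (by fun_prop)]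
    rfl
  refine Measure.ext_of_charFun (E := EuclideanSpace ℝ κ) ?_
  ext t
  rw [hcomp, charFun_map_const_add, charFun_map_mulVec, charFun_multivariateGaussian hA,
    ← Complex.exp_add, real_inner_comm, ← mulVec_mulVec, dotProduct_mulVec, mulVec_transpose]
  congr 1
  ring

/-- The linear transformation of a pair of standard normal variables into a pair of rewards. -/
def rewardPair (μ μ' σ σ' ρ : ℝ) (q : ℝ × ℝ) : ℝ × ℝ :=
  (μ + σ * (ρ * q.1 + √(1 - ρ ^ 2) * q.2), μ' + σ' * q.1)

lemma measurable_rewardPair (μ μ' σ σ' ρ : ℝ) : Measurable (rewardPair μ μ' σ σ' ρ) := by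
  unfold rewardPair
  fun_prop

lemma map_multivariateGaussian_two {ρ : ℝ} (hρ : |ρ| ≤ 1) (μ μ' σ σ' : ℝ) :
    (multivariateGaussian !₂[μ, μ'] !![σ ^ 2, ρ * σ * σ'; ρ * σ * σ', σ' ^ 2]).map
        (fun x => (x 0, x 1)) =
      ((gaussianReal 0 1).prod (gaussianReal 0 1)).map (rewardPair μ μ' σ σ' ρ) := by
  have h1 : 0 ≤ 1 - ρ ^ 2 := by
    have := (sq_le_one_iff_abs_le_one ρ).2 hρ
    linarith
  have hA : !![σ ^ 2, ρ * σ * σ'; ρ * σ * σ', σ' ^ 2] =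
      !![σ * ρ, σ * √(1 - ρ ^ 2); σ', 0] * !![σ * ρ, σ * √(1 - ρ ^ 2); σ', 0]ᵀ := by
    have := Real.mul_self_sqrt h1
    ext i j
    fin_cases i <;> fin_cases j <;> simp only [mul_apply, Fin.sum_univ_two] <;> simp
    · linear_combination (-σ ^ 2) * this
    · exact Or.inl (mul_comm _ _)
    · ring
    · ring
  rw [hA, multivariateGaussian_mul_transpose,
    ← (measurePreserving_finTwoArrow (gaussianReal 0 1)).map_eq,
    Measure.map_map (by fun_prop) (by fun_prop),
    Measure.map_map (measurable_rewardPair _ _ _ _ _) (by fun_prop)]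
  congr 1
  ext x
  · simp [rewardPair, dotProduct, Fin.sum_univ_two]
    ring
  · simp [rewardPair, dotProduct, Fin.sum_univ_two]

/-- The law of `n + n + N` independent standard normal variables that generate the data. -/
abbrev sourceLaw (n N : ℕ) : Measure (((Fin n → ℝ) × (Fin n → ℝ)) × (Fin N → ℝ)) :=
  ((stdNormal (Fin n)).prod (stdNormal (Fin n))).prod (stdNormal (Fin N))

lemma IsGaussianArm.hasLaw {Ω : Type*} [MeasurableSpace Ω] {P : Measure Ω}
    [IsProbabilityMeasure P] {n N : ℕ} {R Rhat : Fin n → Ω → ℝ} {Roff : Fin N → Ω → ℝ}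
    {μ μ' σ σ' ρ : ℝ} (h : IsGaussianArm P R Rhat Roff μ μ' σ σ' ρ) (hρ : |ρ| ≤ 1) :
    HasLaw (fun ω => (fun s => (R s ω, Rhat s ω), fun s => Roff s ω))
      ((sourceLaw n N).map fun p =>
        (fun s => rewardPair μ μ' σ σ' ρ (p.1.1 s, p.1.2 s), fun s => μ' + σ' * p.2 s)) P := by
  have hpair : ∀ s, HasLaw (fun ω => (R s ω, Rhat s ω))
      (((gaussianReal 0 1).prod (gaussianReal 0 1)).map (rewardPair μ μ' σ σ' ρ)) P := by
    intro s
    have hm : HasLaw (fun x : EuclideanSpace ℝ (Fin 2) => (x 0, x 1))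
        (((gaussianReal 0 1).prod (gaussianReal 0 1)).map (rewardPair μ μ' σ σ' ρ))
        (multivariateGaussian !₂[μ, μ'] !![σ ^ 2, ρ * σ * σ'; ρ * σ * σ', σ' ^ 2]) :=
      ⟨by fun_prop, map_multivariateGaussian_two hρ μ μ' σ σ'⟩
    exact hm.comp (h.law_online s)
  have hoff : ∀ s, HasLaw (Roff s) ((gaussianReal 0 1).map fun x => μ' + σ' * x) P := by
    intro s
    have hc : (gaussianReal 0 1).map (fun x => μ' + σ' * x) =
        gaussianReal μ' (σ' ^ 2).toNNReal := by
      have := Measure.map_map (μ := gaussianReal 0 1) (g := (μ' + ·)) (f := (σ' * ·))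
        (by fun_prop) (by fun_prop)
      rw [gaussianReal_map_const_mul, gaussianReal_map_const_add] at this
      rw [Function.comp_def] at this
      rw [← this]
      congr 1
      · ring
      · rw [mul_one]
        ext
        simp [sq_nonneg]
    rw [hc]
    exact h.law_offline s
  have hjoint := h.indep_online_offline.hasLaw_prod (h.indep_online.hasLaw_pi hpair)
    (h.indep_offline.hasLaw_pi hoff)
  have hmp : MeasurePreserving (rewardPair μ μ' σ σ' ρ)
      ((gaussianReal 0 1).prod (gaussianReal 0 1))
      (((gaussianReal 0 1).prod (gaussianReal 0 1)).map (rewardPair μ μ' σ σ' ρ)) :=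
    (measurable_rewardPair _ _ _ _ _).measurePreserving _
  have hmo : MeasurePreserving (fun x => μ' + σ' * x) (gaussianReal 0 1)
      ((gaussianReal 0 1).map fun x => μ' + σ' * x) :=
    (by fun_prop : Measurable fun x => μ' + σ' * x).measurePreserving _
  have i1 : IsProbabilityMeasure
      (((gaussianReal 0 1).prod (gaussianReal 0 1)).map (rewardPair μ μ' σ σ' ρ)) :=
    Measure.isProbabilityMeasure_map (measurable_rewardPair _ _ _ _ _).aemeasurable
  have i2 : IsProbabilityMeasure ((gaussianReal 0 1).map fun x => μ' + σ' * x) :=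
    Measure.isProbabilityMeasure_map (by fun_prop)
  have h1 := (measurePreserving_pi (fun _ : Fin n => _) _ fun _ => hmp).comp
    (measurePreserving_arrowProdEquivProdArrow ℝ ℝ (Fin n) (fun _ => gaussianReal 0 1)
      fun _ => gaussianReal 0 1).symm
  have h2 := h1.prod (measurePreserving_pi (fun _ : Fin N => _) _ fun _ => hmo)
  rw [← h2.map_eq] at hjoint
  exact hjoint

end Model

/-! ### Orthonormal coordinates for the statistics. -/

section Statistics

variable {n N : ℕ}

lemma sum_eq_card_mul_mean (x : Fin n → ℝ) : ∑ s, x s = n * mean x := by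
  rcases Nat.eq_zero_or_pos n with h | h
  · subst h
    simp
  · have : (n : ℝ) ≠ 0 := by positivity
    simp only [mean]
    field_simp

lemma sum_sub_mean (x : Fin n → ℝ) : ∑ s, (x s - mean x) = 0 := by
  rw [Finset.sum_sub_distrib, sum_eq_card_mul_mean]
  simp

lemma sum_sq_sub_mean (x : Fin n → ℝ) :
    ∑ s, (x s - mean x) ^ 2 = ∑ s, x s ^ 2 - n * mean x ^ 2 := by
  have h : ∀ s, (x s - mean x) ^ 2 = x s ^ 2 - 2 * mean x * (x s - mean x) - mean x ^ 2 :=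
    fun s => by ring
  simp only [h, Finset.sum_sub_distrib, ← Finset.mul_sum]
  simp [sum_eq_card_mul_mean]

lemma mean_affine (hn : n ≠ 0) (a b : ℝ) (x : Fin n → ℝ) :
    mean (fun s => a + b * x s) = a + b * mean x := by
  have : (n : ℝ) ≠ 0 := by exact_mod_cast hn
  simp only [mean, Finset.sum_add_distrib, ← Finset.mul_sum]
  simp
  field_simp

/-- Orthonormal contrasts, whose squares add up to the centred sum of squares. -/
lemma exists_orthonormal_contrasts {d : ℕ} (hn : n = d + 1) :
    ∃ E : Matrix (Fin d) (Fin n) ℝ, E * Eᵀ = 1 ∧ (∀ j, ∑ s, E j s = 0) ∧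
      ∀ x : Fin n → ℝ, ∑ s, (x s - mean x) ^ 2 = ∑ j, (E *ᵥ x) j ^ 2 := by
  have hn0 : (0 : ℝ) < n := by exact_mod_cast (by lia : 0 < n)
  have hs : √(n : ℝ) * √n = n := Real.mul_self_sqrt hn0.le
  have hs0 : 0 < √(n : ℝ) := Real.sqrt_pos.2 hn0
  let A : Matrix Unit (Fin n) ℝ := of fun _ _ => 1 / √n
  have hA : A * Aᵀ = 1 := by
    ext i j
    simp [A, mul_apply]
    field_simp
    linarith
  obtain ⟨E, h1, h2⟩ := exists_orthonormal_completion (d := d) A hA (by simp [hn]; ring)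
  rw [transpose_fromRows, fromRows_mul_fromCols, ← fromBlocks_one, fromBlocks_inj] at h1
  obtain ⟨-, -, hEA, hE⟩ := h1
  refine ⟨E, hE, fun j => ?_, fun x => ?_⟩
  · have := congrFun (congrFun hEA j) ()
    simp only [A, mul_apply, transpose_apply, of_apply, Matrix.zero_apply, ← Finset.sum_mul] at this
    rcases mul_eq_zero.1 this with h | h
    · exact h
    · exact absurd h (by positivity)
  · have h := dotProduct_self_eq_of_completion h2 x
    have hx : (A *ᵥ x) () = √n * mean x := by
      simp only [A, mulVec, dotProduct, of_apply, ← Finset.mul_sum, sum_eq_card_mul_mean]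
      field_simp
      rw [sq, hs]
    simp only [dotProduct, Finset.univ_unique, Finset.sum_singleton] at h
    rw [show (default : Unit) = () from rfl, hx] at h
    rw [sum_sq_sub_mean]
    simp only [sq]
    linear_combination h + mean x ^ 2 * hs

/-- The least squares fit passes through the means. -/
lemma mlaMean_eq_mean_sub (hn : n ≠ 0) (r rh : Fin n → ℝ) (roff : Fin N → ℝ) :
    mlaMean r rh roff = mean r - olsSlope r rh * (mean rh - pooledMean rh roff) := by
  have hn0 : (0 : ℝ) < n := by exact_mod_cast (by lia : 0 < n)
  have : (n : ℝ) + N ≠ 0 := by positivity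
  simp only [mlaMean, lambdaHat, olsSlope, pooledMean, sum_eq_card_mul_mean]
  field_simp
  ring

/-- Conditionally on the surrogate rewards, the estimation error and the residual sum of squares
are a linear form and a quadratic form in the noise, in orthogonal directions. -/
lemma exists_orthonormal_regression {d : ℕ} (hn : n = d + 2) (rh : Fin n → ℝ) (roff : Fin N → ℝ)
    (hS : 0 < ∑ s, (rh s - mean rh) ^ 2) :
    ∃ C : Matrix (Unit ⊕ Fin d) (Fin n) ℝ, C * Cᵀ = 1 ∧ ∀ (ξ : Fin n → ℝ) (a b τ : ℝ),
      mlaMean (fun s => a + b * rh s + τ * ξ s) rh roff =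
        a + b * pooledMean rh roff - τ * (√(zFactor rh roff / n) * (C *ᵥ ξ) (Sum.inl ())) ∧
      residVar (fun s => a + b * rh s + τ * ξ s) rh roff =
        τ ^ 2 * ((∑ j, (C *ᵥ ξ) (Sum.inr j) ^ 2) / d) := by
  have hn0 : (0 : ℝ) < n := by exact_mod_cast (by lia : 0 < n)
  have hn1 : n ≠ 0 := by lia
  set S := ∑ s, (rh s - mean rh) ^ 2 with hSdef
  set M := pooledMean rh roff with hM
  set k := mean rh - M with hk
  set h : Fin n → ℝ := fun s => rh s - mean rh with hh
  have hh0 : ∑ s, h s = 0 := sum_sub_mean rh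
  have hh2 : ∑ s, h s ^ 2 = S := rfl
  have hrsq : zFactor rh roff / n = 1 / n + k ^ 2 / S := by
    rw [zFactor, ← hSdef, ← hM, ← hk]
    field_simp
  set r := √(zFactor rh roff / n) with hr
  have hr2 : r ^ 2 = 1 / n + k ^ 2 / S := by
    rw [hr, hrsq, Real.sq_sqrt (by positivity)]
  have hr0 : 0 < r := by
    rw [hr, hrsq]
    positivity
  set t := √((n : ℝ) * S) with ht
  have ht2 : t ^ 2 = n * S := Real.sq_sqrt (by positivity)
  have ht0 : 0 < t := Real.sqrt_pos.2 (by positivity)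
  -- An orthonormal basis of the span of the constants and `h`. Row `0` is, up to sign and
  -- normalization, the coefficient vector of the fitted value at `M`, of squared length `r² = Z/n`;
  -- row `1` is orthogonal to it in the plane. The minus sign makes row `0` measure underestimation.
  let A : Matrix (Fin 2) (Fin n) ℝ :=
    ![fun s => -(1 / n - k * h s / S) / r, fun s => (k + h s) / (r * t)]
  have hA0 (x : Fin n → ℝ) : (A *ᵥ x) 0 = -((∑ s, x s) / n - k / S * ∑ s, h s * x s) / r := by
    simp only [A, mulVec, dotProduct, Finset.sum_div, Finset.mul_sum, ← Finset.sum_sub_distrib,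
      ← Finset.sum_neg_distrib]
    simp
    refine Finset.sum_congr rfl fun s _ => ?_
    field_simp
  have hA1 (x : Fin n → ℝ) : (A *ᵥ x) 1 = (k * (∑ s, x s) + ∑ s, h s * x s) / (r * t) := by
    simp only [A, mulVec, dotProduct, Finset.sum_div, Finset.mul_sum, ← Finset.sum_add_distrib]
    simp
    refine Finset.sum_congr rfl fun s _ => ?_
    field_simp
  have hsum0 : ∑ s, A 0 s = -1 / r := by
    have : ∀ s, A 0 s = -1 / (n * r) + k / (S * r) * h s := fun s => by
      simp [A]
      field_simp
      ring
    simp only [this, Finset.sum_add_distrib, ← Finset.mul_sum, hh0]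
    simp
    field_simp
  have hsum1 : ∑ s, A 1 s = n * k / (r * t) := by
    have : ∀ s, A 1 s = k / (r * t) + 1 / (r * t) * h s := fun s => by
      simp [A]
      field_simp
    simp only [this, Finset.sum_add_distrib, ← Finset.mul_sum, hh0]
    simp
    field_simp
  have hhsum0 : ∑ s, h s * A 0 s = k / r := by
    have : ∀ s, h s * A 0 s = -1 / (n * r) * h s + k / (S * r) * h s ^ 2 := fun s => by
      simp [A]
      field_simp
      ring
    simp only [this, Finset.sum_add_distrib, ← Finset.mul_sum, hh0, hh2]
    field_simp
    ring
  have hhsum1 : ∑ s, h s * A 1 s = S / (r * t) := by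
    have : ∀ s, h s * A 1 s = k / (r * t) * h s + 1 / (r * t) * h s ^ 2 := fun s => by
      simp [A]
      field_simp
    simp only [this, Finset.sum_add_distrib, ← Finset.mul_sum, hh0, hh2]
    field_simp
    ring
  have hr3 : r ^ 2 * (n * S) = S + n * k ^ 2 := by
    rw [hr2]
    field_simp
  have e00 : (A *ᵥ A 0) 0 = 1 := by
    rw [hA0, hsum0, hhsum0]
    field_simp
    linarith
  have e01 : (A *ᵥ A 1) 0 = 0 := by
    rw [hA0, hsum1, hhsum1]
    field_simp
    ring
  have e11 : (A *ᵥ A 1) 1 = 1 := by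
    rw [hA1, hsum1, hhsum1]
    field_simp
    rw [ht2]
    linarith
  have hA : A * Aᵀ = 1 := by
    have key : ∀ i j, (A * Aᵀ) i j = (A *ᵥ A j) i := fun i j => rfl
    ext i j
    fin_cases i <;> fin_cases j
    · simpa [key] using e00
    · simpa [key] using e01
    · have : (A * Aᵀ) 1 0 = (A * Aᵀ) 0 1 := by
        rw [← transpose_apply (A * Aᵀ), transpose_mul, transpose_transpose]
      simpa [this, key] using e01
    · simpa [key] using e11
  obtain ⟨B, h1, h2⟩ := exists_orthonormal_completion (d := d) A hA (by simp [hn]; ring)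
  rw [transpose_fromRows, fromRows_mul_fromCols, ← fromBlocks_one, fromBlocks_inj] at h1
  obtain ⟨-, hAB, hBA, hB⟩ := h1
  -- Row `1` of `A` is dropped: `B` spans the complement of the whole plane and yields the
  -- residuals, hence `n - 2` degrees of freedom.
  refine ⟨fromRows (of fun _ => A 0) B, ?_, fun ξ a b τ => ?_⟩
  · rw [transpose_fromRows, fromRows_mul_fromCols, ← fromBlocks_one, fromBlocks_inj]
    refine ⟨?_, ?_, ?_, hB⟩
    · ext i j
      exact e00
    · ext i j
      exact congrFun (congrFun hAB 0) j
    · ext i j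
      exact congrFun (congrFun hBA i) 0
  set x := ∑ s, ξ s with hx
  set y := ∑ s, h s * ξ s with hy
  have hCl : (fromRows (of fun _ => A 0) B *ᵥ ξ) (Sum.inl () : Unit ⊕ Fin d) = (A *ᵥ ξ) 0 := rfl
  have hCr (j : Fin d) :
    (fromRows (of fun _ : Unit => A 0) B *ᵥ ξ) (Sum.inr j) = (B *ᵥ ξ) j := rfl
  simp only [hCl, hCr]
  set R : Fin n → ℝ := fun s => a + b * rh s + τ * ξ s with hR
  have hmean : mean R = a + b * mean rh + τ * (x / n) := by
    simp only [hR, mean, Finset.sum_add_distrib, ← Finset.mul_sum]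
    simp
    field_simp
    ring
  have hcov : ∑ s, (R s - mean R) * (rh s - mean rh) = b * S + τ * y := by
    have : ∀ s, (R s - mean R) * (rh s - mean rh) =
        b * h s ^ 2 + τ * (h s * ξ s) - τ * (x / n) * h s := fun s => by
      rw [hmean, hR, hh]
      ring
    simp only [this, Finset.sum_sub_distrib, Finset.sum_add_distrib, ← Finset.mul_sum, hh0, hh2,
      ← hy]
    ring
  have hslope : olsSlope R rh = b + τ * (y / S) := by
    rw [olsSlope, sampleCov, sampleVar, hcov, ← hSdef]
    field_simp
  have hmla : mlaMean R rh roff = mean R - olsSlope R rh * k := mlaMean_eq_mean_sub hn1 R rh roff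
  constructor
  · rw [hmla, hmean, hslope, hA0, ← hx, ← hy]
    rw [hk]
    field_simp
    ring
  · have hres : ∀ s, (R s - mlaMean R rh roff - olsSlope R rh * (rh s - M)) ^ 2 =
        τ ^ 2 * (ξ s ^ 2 - 2 * (x / n) * ξ s - 2 * (y / S) * (h s * ξ s)
          + 2 * (x / n) * (y / S) * h s + (x / n) ^ 2 + (y / S) ^ 2 * h s ^ 2) := fun s => by
      rw [hmla, hmean, hslope, hR, hh, hk]
      ring
    have hsq := dotProduct_self_eq_of_completion h2 ξ
    simp only [dotProduct, Fin.sum_univ_two, hA0, hA1, ← hx, ← hy, ← sq] at hsq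
    have hd : (n : ℝ) - 2 = d := by
      rw [hn]
      push_cast
      ring
    have hform : ∑ j, (B *ᵥ ξ) j ^ 2 = ∑ s, ξ s ^ 2 - x ^ 2 / n - y ^ 2 / S := by
      have : (-(x / n - k / S * y) / r) ^ 2 + ((k * x + y) / (r * t)) ^ 2 =
          x ^ 2 / n + y ^ 2 / S := by
        simp only [div_pow, mul_pow, ht2, hr2]
        field_simp
        ring
      linarith
    rw [residVar, ← hM, hd, Finset.sum_congr rfl fun s _ => hres s, hform, ← Finset.mul_sum]
    simp only [Finset.sum_sub_distrib, Finset.sum_add_distrib, ← Finset.mul_sum, hh0, hh2,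
      ← hx, ← hy]
    simp
    field_simp
    ring

/-- The deviation of the pooled surrogate mean and the sample variance of the rewards are a linear
form and a quadratic form in the source noise, in orthogonal directions. -/
lemma exists_orthonormal_pooled {d : ℕ} (hn : n = d + 1) (N : ℕ) {ρ : ℝ} (hρ : |ρ| ≤ 1) :
    ∃ C : Matrix (Unit ⊕ Fin d) ((Fin n ⊕ Fin n) ⊕ Fin N) ℝ, C * Cᵀ = 1 ∧
      ∀ (η ξ : Fin n → ℝ) (ζ : Fin N → ℝ),
        -ρ * ((∑ s, η s + ∑ s, ζ s) / √((n : ℝ) + N)) =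
          |ρ| * (C *ᵥ Sum.elim (Sum.elim η ξ) ζ) (Sum.inl ()) ∧
        ∑ s, ((ρ * η s + √(1 - ρ ^ 2) * ξ s) - mean fun s => ρ * η s + √(1 - ρ ^ 2) * ξ s) ^ 2 =
          ∑ j, (C *ᵥ Sum.elim (Sum.elim η ξ) ζ) (Sum.inr j) ^ 2 := by
  have h1 : 0 ≤ 1 - ρ ^ 2 := by
    have := (sq_le_one_iff_abs_le_one ρ).2 hρ
    linarith
  have hn0 : (0 : ℝ) < n := by exact_mod_cast (by lia : 0 < n)
  have hτ := Real.mul_self_sqrt h1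
  set τ := √(1 - ρ ^ 2)
  have hm : √((n : ℝ) + N) * √((n : ℝ) + N) = n + N := Real.mul_self_sqrt (by positivity)
  have hm0 : 0 < √((n : ℝ) + N) := Real.sqrt_pos.2 (by positivity)
  set m := √((n : ℝ) + N)
  -- The sign `e` is kept apart so that the first row has unit length even when `ρ = 0`.
  obtain ⟨e, he, hρe⟩ : ∃ e : ℝ, e * e = 1 ∧ -ρ = |ρ| * e := by
    rcases abs_cases ρ with ⟨h, -⟩ | ⟨h, -⟩
    · exact ⟨-1, by norm_num, by rw [h]; ring⟩
    · exact ⟨1, by norm_num, by rw [h]; ring⟩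
  obtain ⟨E, hE, hE0, hEsq⟩ := exists_orthonormal_contrasts hn
  have hEE (i j : Fin d) : ∑ s, E i s * E j s = if i = j then 1 else 0 := by
    rw [← one_apply, ← hE]
    rfl
  -- Rows built from `E` are orthogonal to the first because contrasts sum to zero, and orthonormal
  -- among themselves because `ρ² + τ² = 1`.
  refine ⟨fromRows (of fun _ => Sum.elim (Sum.elim (fun _ => e / m) fun _ => 0) fun _ => e / m)
    (of fun j => Sum.elim (Sum.elim (fun s => ρ * E j s) fun s => τ * E j s) fun _ => 0), ?_, ?_⟩
  · rw [transpose_fromRows, fromRows_mul_fromCols, ← fromBlocks_one, fromBlocks_inj]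
    refine ⟨?_, ?_, ?_, ?_⟩
    · ext i j
      simp [mul_apply]
      field_simp
      rw [sq, sq, he, hm]
      ring
    · ext i j
      simp [mul_apply, ← Finset.mul_sum, hE0]
    · ext i j
      simp [mul_apply, ← Finset.mul_sum, ← Finset.sum_mul, hE0]
    · ext i j
      have hp (c : ℝ) : ∑ s, c * E i s * (c * E j s) = c * c * ∑ s, E i s * E j s := by
        rw [Finset.mul_sum]
        exact Finset.sum_congr rfl fun s _ => by ring
      simp only [mul_apply, transpose_apply, of_apply, Fintype.sum_sum_type, Sum.elim_inl,
        Sum.elim_inr, hp, hEE, one_apply]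
      simp only [mul_zero, Finset.sum_const_zero, add_zero, ← add_mul, hτ]
      ring
  · intro η ξ ζ
    constructor
    · simp only [mulVec, dotProduct, Fintype.sum_sum_type, fromRows_apply_inl, of_apply,
        Sum.elim_inl, Sum.elim_inr, ← Finset.mul_sum, hρe]
      simp
      ring
    · rw [hEsq]
      refine Finset.sum_congr rfl fun j _ => ?_
      congr 1
      simp only [mulVec, dotProduct, Fintype.sum_sum_type, fromRows_apply_inr, of_apply,
        Sum.elim_inl, Sum.elim_inr]
      simp only [zero_mul, Finset.sum_const_zero, add_zero, ← Finset.sum_add_distrib]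
      exact Finset.sum_congr rfl fun s _ => by ring

end Statistics

/-! ### Tail bounds for the two error terms. -/

section Coverage

variable {n N : ℕ}

lemma rewardVar_affine (hn : n ≠ 0) (a b : ℝ) (x : Fin n → ℝ) :
    rewardVar (fun s => a + b * x s) = 1 / ((n : ℝ) - 1) * (b ^ 2 * ∑ s, (x s - mean x) ^ 2) := by
  rw [rewardVar, mean_affine hn]
  congr 1
  rw [Finset.mul_sum]
  exact Finset.sum_congr rfl fun s _ => by ring

lemma ae_sum_sq_sub_mean_pos (hn : 2 ≤ n) :
    ∀ᵐ x ∂stdNormal (Fin n), 0 < ∑ s, (x s - mean x) ^ 2 := by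
  obtain ⟨d, rfl⟩ : ∃ d, n = d + 1 := ⟨n - 1, by lia⟩
  obtain ⟨E, hE, -, hsq⟩ := exists_orthonormal_contrasts (n := d + 1) rfl
  have h : MeasurePreserving (fun x => E *ᵥ x) (stdNormal (Fin (d + 1))) (stdNormal (Fin d)) :=
    ⟨by fun_prop, map_mulVec_stdNormal E hE⟩
  filter_upwards [h.quasiMeasurePreserving.ae (ae_sum_sq_pos (by lia : 1 ≤ d))] with x hx
  rwa [hsq]

/-- Given the surrogate rewards, the regression part of the error exceeds its bound with probability
at most the tail of Student's t-distribution with `n - 2` degrees of freedom. -/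
lemma measure_regression_error_le {d : ℕ} (hn : n = d + 2) (hd : 1 ≤ d) (q : ℝ)
    (rh : Fin n → ℝ) (roff : Fin N → ℝ) (hS : 0 < ∑ s, (rh s - mean rh) ^ 2)
    (a b : ℝ) {τ : ℝ} (hτ : 0 ≤ τ) :
    stdNormal (Fin n) {ξ | q * √(zFactor rh roff *
        residVar (fun s => a + b * rh s + τ * ξ s) rh roff / n) <
      a + b * pooledMean rh roff - mlaMean (fun s => a + b * rh s + τ * ξ s) rh roff} ≤
    studentT d (Set.Ioi q) := by
  obtain ⟨C, hC, hform⟩ := exists_orthonormal_regression hn rh roff hS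
  rw [← studentT_Ioi_eq_of_orthonormal hd hC q]
  refine measure_mono fun ξ hξ => ?_
  simp only [Set.mem_ofPred_eq] at hξ ⊢
  obtain ⟨h1, h2⟩ := hform ξ a b τ
  have hsqrt : √(zFactor rh roff * residVar (fun s => a + b * rh s + τ * ξ s) rh roff / n) =
      √(zFactor rh roff / n) * τ * √((∑ j, (C *ᵥ ξ) (Sum.inr j) ^ 2) / d) := by
    rw [h2, ← Real.sqrt_sq hτ, mul_assoc, ← Real.sqrt_mul (by positivity), ← Real.sqrt_mul
      (by unfold zFactor; positivity), Real.sqrt_sq hτ]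
    congr 1
    ring
  rw [hsqrt, h1] at hξ
  -- The weight may vanish (when `τ = 0`); the strict inequality `hξ` is then impossible.
  have hw : 0 ≤ √(zFactor rh roff / n) * τ := by positivity
  refine lt_of_mul_lt_mul_left ?_ hw
  linarith

/-- The deviation of the pooled surrogate mean exceeds its bound with probability at most the tail
of Student's t-distribution with `n - 1` degrees of freedom. -/
lemma measure_pooled_error_le {d : ℕ} (hn : n = d + 1) (hd : 1 ≤ d) {q : ℝ} (hq : 0 ≤ q)
    (μ : ℝ) {σ ρ : ℝ} (hσ : 0 ≤ σ) (hρ : |ρ| ≤ 1) :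
    sourceLaw n N {p | q * √(rewardVar (fun s => μ + σ * (ρ * p.1.1 s + √(1 - ρ ^ 2) * p.1.2 s))
        / ((n : ℝ) + N)) < -(σ * ρ * ((∑ s, p.1.1 s + ∑ s, p.2 s) / ((n : ℝ) + N)))} ≤
    studentT d (Set.Ioi q) := by
  obtain ⟨C, hC, hform⟩ := exists_orthonormal_pooled hn N hρ
  have hn0 : (0 : ℝ) < n := by exact_mod_cast (by lia : 0 < n)
  have hn1 : (n : ℝ) - 1 = d := by rw [hn]; push_cast; ring
  have h1 := (measurePreserving_sumPiEquivProdPi_symm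
    (fun _ : Fin n ⊕ Fin n => gaussianReal 0 1)).prod (MeasurePreserving.id (stdNormal (Fin N)))
  have h2 := (measurePreserving_sumPiEquivProdPi_symm
    (fun _ : (Fin n ⊕ Fin n) ⊕ Fin N => gaussianReal 0 1)).comp h1
  rw [← studentT_Ioi_eq_of_orthonormal hd hC q, ← h2.measure_preimage
    (measurableSet_lt (by fun_prop) (by fun_prop)).nullMeasurableSet]
  refine measure_mono fun p hp => ?_
  obtain ⟨⟨η, ξ⟩, ζ⟩ := p
  change q * √((∑ j, (C *ᵥ Sum.elim (Sum.elim η ξ) ζ) (Sum.inr j) ^ 2) / d) <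
    (C *ᵥ Sum.elim (Sum.elim η ξ) ζ) (Sum.inl ())
  simp only [Set.mem_ofPred_eq] at hp
  obtain ⟨h3, h4⟩ := hform η ξ ζ
  set X := (C *ᵥ Sum.elim (Sum.elim η ξ) ζ) (Sum.inl ())
  set Y := ∑ j, (C *ᵥ Sum.elim (Sum.elim η ξ) ζ) (Sum.inr j) ^ 2
  have hm : √((n : ℝ) + N) * √((n : ℝ) + N) = n + N := Real.mul_self_sqrt (by positivity)
  have hm0 : 0 < √((n : ℝ) + N) := Real.sqrt_pos.2 (by positivity)
  have hY : 0 ≤ Y := Finset.sum_nonneg fun j _ => sq_nonneg _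
  have hl : √(rewardVar (fun s => μ + σ * (ρ * η s + √(1 - ρ ^ 2) * ξ s)) / ((n : ℝ) + N)) =
      σ / √((n : ℝ) + N) * √(Y / d) := by
    rw [rewardVar_affine (by lia), h4, hn1, Real.sqrt_div' _ (by positivity),
      show 1 / (d : ℝ) * (σ ^ 2 * Y) = σ ^ 2 * (Y / d) by ring, Real.sqrt_mul (sq_nonneg σ),
      Real.sqrt_sq hσ]
    ring
  have hr : -(σ * ρ * ((∑ s, η s + ∑ s, ζ s) / ((n : ℝ) + N))) =
      σ / √((n : ℝ) + N) * (|ρ| * X) := by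
    rw [← h3]
    nth_rewrite 1 [← hm]
    set m := √((n : ℝ) + N)
    field_simp
  rw [hl, hr] at hp
  have hlt : q * √(Y / d) < |ρ| * X := by
    refine lt_of_mul_lt_mul_left ?_ (by positivity : 0 ≤ σ / √((n : ℝ) + N))
    linarith
  -- Here `0 ≤ q` matters: it forces `X > 0`, so that the factor `|ρ| ≤ 1` can be dropped.
  have hX : 0 < X := by
    have : 0 < |ρ| * X := lt_of_le_of_lt (by positivity) hlt
    exact pos_of_mul_pos_right this (abs_nonneg ρ)
  exact hlt.trans_le (mul_le_of_le_one_left hX.le hρ)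

/-- The conditional bound does not depend on the surrogates, so integrating over `η` and `ζ`
preserves it; surrogates that are all equal form a null set. -/
lemma measure_regression_error_source_le {d : ℕ} (hn : n = d + 2) (hd : 1 ≤ d) (q : ℝ)
    (a b μ' : ℝ) {τ σ' : ℝ} (hτ : 0 ≤ τ) (hσ' : 0 < σ') :
    sourceLaw n N {p | q * √(zFactor (fun s => μ' + σ' * p.1.1 s) (fun s => μ' + σ' * p.2 s) *
        residVar (fun s => a + b * (μ' + σ' * p.1.1 s) + τ * p.1.2 s)
          (fun s => μ' + σ' * p.1.1 s) (fun s => μ' + σ' * p.2 s) / n) <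
      a + b * pooledMean (fun s => μ' + σ' * p.1.1 s) (fun s => μ' + σ' * p.2 s) -
        mlaMean (fun s => a + b * (μ' + σ' * p.1.1 s) + τ * p.1.2 s)
          (fun s => μ' + σ' * p.1.1 s) (fun s => μ' + σ' * p.2 s)} ≤
    studentT d (Set.Ioi q) := by
  set A := {p : ((Fin n → ℝ) × (Fin n → ℝ)) × (Fin N → ℝ) | _} with hA
  have hAmeas : MeasurableSet A := by
    simp only [hA, zFactor, residVar, mlaMean, pooledMean, olsSlope, lambdaHat, sampleCov,
      sampleVar, mean]
    exact measurableSet_lt (by fun_prop) (by fun_prop)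
  rw [Measure.prod_apply_symm hAmeas]
  refine (lintegral_mono fun ζ => ?_).trans_eq (by simp : ∫⁻ _, studentT d (Set.Ioi q)
    ∂stdNormal (Fin N) = studentT d (Set.Ioi q))
  rw [Measure.prod_apply (measurable_prodMk_right hAmeas)]
  refine (lintegral_mono_ae ?_).trans_eq (by simp : ∫⁻ _, studentT d (Set.Ioi q)
    ∂stdNormal (Fin n) = studentT d (Set.Ioi q))
  filter_upwards [ae_sum_sq_sub_mean_pos (by lia : 2 ≤ n)] with η hη
  have hS : 0 < ∑ s, ((fun s => μ' + σ' * η s) s - mean fun s => μ' + σ' * η s) ^ 2 := by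
    rw [mean_affine (by lia)]
    have : ∀ s, (μ' + σ' * η s - (μ' + σ' * mean η)) ^ 2 = σ' ^ 2 * (η s - mean η) ^ 2 :=
      fun s => by ring
    simp only [this, ← Finset.mul_sum]
    positivity
  exact measure_regression_error_le hn hd q (fun s => μ' + σ' * η s)
    (fun s => μ' + σ' * ζ s) hS a b hτ

end Coverage

end

end MLAUCB


/-! ### Union bound over the two error terms. -/

theorem mainTheorem4 {Ω : Type*} [MeasurableSpace Ω] (P : Measure Ω) [IsProbabilityMeasure P]
    (n N : ℕ) (hn : 3 ≤ n)
    (μ μ' σ σ' ρ : ℝ) (hσ : 0 ≤ σ) (hσ' : 0 < σ') (hρ : |ρ| ≤ 1)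
    (R Rhat : Fin n → Ω → ℝ) (Roff : Fin N → Ω → ℝ)
    (hmodel : MLAUCB.IsGaussianArm P R Rhat Roff μ μ' σ σ' ρ)
    (δ : ℝ) (hδ : 0 < δ) (hδ' : δ < 1) :
    1 - 2 * δ ≤ P.real {ω | μ ≤
      MLAUCB.mlaMean (fun s => R s ω) (fun s => Rhat s ω) (fun s => Roff s ω)
        + MLAUCB.tQuantile (n - 2) δ *
          (√(MLAUCB.rewardVar (fun s => R s ω) / ((n : ℝ) + N))
            + √(MLAUCB.zFactor (fun s => Rhat s ω) (fun s => Roff s ω)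
                * MLAUCB.residVar (fun s => R s ω) (fun s => Rhat s ω) (fun s => Roff s ω)
                / n))} := by
  -- For `δ ≥ 1/2` the claimed lower bound is nonpositive; otherwise the quantile is nonnegative.
  rcases le_or_gt (1 / 2) δ with hhalf | hhalf
  · exact le_trans (by linarith) measureReal_nonneg
  obtain ⟨d, hnd⟩ : ∃ d, n = d + 2 := ⟨n - 2, by lia⟩
  have hd : 1 ≤ d := by lia
  have hnd2 : n - 2 = d := by lia
  rw [hnd2]
  set q := MLAUCB.tQuantile d δ
  have hq0 : 0 ≤ q := MLAUCB.tQuantile_nonneg hhalf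
  have hn0 : (0 : ℝ) < n := by exact_mod_cast (by lia : 0 < n)
  have hN0 : (n : ℝ) + N ≠ 0 := by positivity
  have htail : MLAUCB.studentT d (Set.Ioi q) ≤ ENNReal.ofReal δ :=
    (ENNReal.le_ofReal_iff_toReal_le (measure_ne_top _ _) hδ.le).2
      (MLAUCB.studentT_Ioi_tQuantile_le hδ)
  have htail' : MLAUCB.studentT (d + 1) (Set.Ioi q) ≤ ENNReal.ofReal δ :=
    (ENNReal.le_ofReal_iff_toReal_le (measure_ne_top _ _) hδ.le).2
      ((MLAUCB.studentT_succ_Ioi_le hd hq0).trans (MLAUCB.studentT_Ioi_tQuantile_le hδ))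
  have hA := (MLAUCB.measure_regression_error_source_le (N := N) hnd hd q
    (μ - σ * ρ / σ' * μ') (σ * ρ / σ') μ' (by positivity : 0 ≤ σ * √(1 - ρ ^ 2)) hσ').trans htail
  have hB := (MLAUCB.measure_pooled_error_le (N := N) (by lia : n = d + 1 + 1) (by lia) hq0 μ hσ
    hρ).trans htail'
  have hmeas : MeasurableSet {x : (Fin n → ℝ × ℝ) × (Fin N → ℝ) | μ ≤
      MLAUCB.mlaMean (fun s => (x.1 s).1) (fun s => (x.1 s).2) (fun s => x.2 s)
        + q * (√(MLAUCB.rewardVar (fun s => (x.1 s).1) / ((n : ℝ) + N))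
            + √(MLAUCB.zFactor (fun s => (x.1 s).2) (fun s => x.2 s)
                * MLAUCB.residVar (fun s => (x.1 s).1) (fun s => (x.1 s).2) (fun s => x.2 s)
                / n))} := by
    simp only [MLAUCB.zFactor, MLAUCB.residVar, MLAUCB.rewardVar, MLAUCB.mlaMean,
      MLAUCB.pooledMean, MLAUCB.olsSlope, MLAUCB.lambdaHat, MLAUCB.sampleCov, MLAUCB.sampleVar,
      MLAUCB.mean]
    exact measurableSet_le (by fun_prop) (by fun_prop)
  have hT : Measurable fun p : ((Fin n → ℝ) × (Fin n → ℝ)) × (Fin N → ℝ) =>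
      ((fun s => MLAUCB.rewardPair μ μ' σ σ' ρ (p.1.1 s, p.1.2 s), fun s => μ' + σ' * p.2 s) :
        (Fin n → ℝ × ℝ) × (Fin N → ℝ)) := by
    simp only [MLAUCB.rewardPair]
    fun_prop
  rw [(hmodel.hasLaw hρ).measureReal_eq hmeas, map_measureReal_apply hT hmeas]
  have hbad := (measure_union_le _ _).trans (add_le_add hA hB)
  rw [← ENNReal.ofReal_add hδ.le hδ.le] at hbad
  have hbad' := ENNReal.toReal_le_of_le_ofReal (by positivity) hbad
  rw [← measureReal_def] at hbad'
  rw [← compl_compl (_ ⁻¹' _), probReal_compl_eq_one_sub (hT hmeas).compl, ← two_mul δ] at *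
  refine sub_le_sub_left (le_trans (measureReal_mono fun p hp => ?_) hbad') 1
  simp only [Set.mem_compl_iff, Set.mem_preimage, Set.mem_ofPred_eq, MLAUCB.rewardPair,
    not_le] at hp
  have hr : (fun s => μ + σ * (ρ * p.1.1 s + √(1 - ρ ^ 2) * p.1.2 s)) = fun s =>
      (μ - σ * ρ / σ' * μ') + σ * ρ / σ' * (μ' + σ' * p.1.1 s) + σ * √(1 - ρ ^ 2) * p.1.2 s := by
    ext s
    field_simp
    ring
  have hpool : σ * ρ / σ' * (MLAUCB.pooledMean (fun s => μ' + σ' * p.1.1 s)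
      (fun s => μ' + σ' * p.2 s) - μ') =
      σ * ρ * ((∑ s, p.1.1 s + ∑ s, p.2 s) / ((n : ℝ) + N)) := by
    simp only [MLAUCB.pooledMean, Finset.sum_add_distrib, ← Finset.mul_sum]
    simp
    field_simp
    ring
  -- Outside both bad events the two inequalities add up to the confidence bound, since `a + bμ' =
  -- μ`.
  by_contra hnot
  simp only [Set.mem_union, Set.mem_ofPred_eq, not_or, not_lt, ← hr, ← hpool] at hnot
  obtain ⟨h1, h2⟩ := hnot
  linarith
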